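/- Let $\Bbbk$ be a field of characteristic zero and let $W_+$ be the positive Witt algebra over $\Bbbk$, that is, the Lie algebra with basis $\{e_n : n \in \mathbb{Z}_{\geq 1}\}$ and bracket $[e_i,e_j]=(j-i)e_{i+j}$. Equip the symmetric algebra $\mathrm{S}(W_+)$ with the Poisson bracket $\{\cdot,\cdot\}$ that extends the Lie bracket of $W_+$, i.e. the unique biderivation with $\{x,y\}=[x,y]$ for $x,y\in W_+$. An ideal $I$ of $\mathrm{S}(W_+)$ is called Poisson if $\{a,f\}\in I$ for all $a\in \mathrm{S}(W_+)$ and $f\in I$; the Poisson ideal generated by a set $X$ is the smallest Poisson ideal that contains $X$; and a quadratic element is an element of $\mathrm{S}^2(W_+)$, the span of the products of two elements of $W_+$. Then $\mathrm{S}(W_+)$ satisfies the ascending chain condition on Poisson ideals generated by quadratic elements: if $I_0\subseteq I_1\subseteq I_2\subseteq\cdots$ is a chain of ideals of $\mathrm{S}(W_+)$, each of which is the Poisson ideal generated by some set of elements of $\mathrm{S}^2(W_+)$, then there is $N$ such that $I_n=I_N$ for all $n\geq N$. -/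

import Mathlib

noncomputable section

/-- The positive Witt algebra `W₊` over `k`, as the vector space with basis `e n`, `n ≥ 1`. -/
def PositiveWitt (k : Type*) [Field k] : Type _ := ℕ+ →₀ k

namespace PositiveWitt

variable (k : Type*) [Field k]

instance : AddCommGroup (PositiveWitt k) := inferInstanceAs (AddCommGroup (ℕ+ →₀ k))

instance : Module k (PositiveWitt k) := inferInstanceAs (Module k (ℕ+ →₀ k))

/-- The basis `e n`, `n ≥ 1`, of the positive Witt algebra. -/
def e : Module.Basis ℕ+ k (PositiveWitt k) := Module.Basis.ofRepr (LinearEquiv.refl k (ℕ+ →₀ k))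

/-- The bilinear map with `(e i, e j) ↦ (j - i) e (i + j)`. -/
def lieHom : PositiveWitt k →ₗ[k] PositiveWitt k →ₗ[k] PositiveWitt k :=
  (e k).constr k fun i => (e k).constr k fun j => (((j : ℕ) : k) - ((i : ℕ) : k)) • e k (i + j)

theorem lieHom_e (i j : ℕ+) :
    lieHom k (e k i) (e k j) = (((j : ℕ) : k) - ((i : ℕ) : k)) • e k (i + j) := by
  simp [lieHom]

theorem lieHom_skew (x y : PositiveWitt k) : lieHom k x y = -lieHom k y x := by
  have h : lieHom k = -(lieHom k).flip := by
    refine (e k).ext fun i => (e k).ext fun j => ?_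
    simp only [LinearMap.neg_apply, LinearMap.flip_apply, lieHom_e, add_comm j i, ← neg_smul]
    congr 1
    ring
  exact congr($h x y)

theorem lieHom_leibniz (x y z : PositiveWitt k) :
    lieHom k x (lieHom k y z) = lieHom k (lieHom k x y) z + lieHom k y (lieHom k x z) := by
  induction (e k).mem_span x using Submodule.span_induction with
  | zero => simp
  | add x x' _ _ hx hx' => simp only [map_add, LinearMap.add_apply, hx, hx']; abel
  | smul c x _ hx => simp only [map_smul, LinearMap.smul_apply, hx, smul_add]
  | mem x hx =>
  obtain ⟨i, rfl⟩ := hx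
  induction (e k).mem_span y using Submodule.span_induction with
  | zero => simp
  | add x x' _ _ hx hx' => simp only [map_add, LinearMap.add_apply, hx, hx']; abel
  | smul c x _ hx => simp only [map_smul, LinearMap.smul_apply, hx, smul_add]
  | mem x hx =>
  obtain ⟨j, rfl⟩ := hx
  induction (e k).mem_span z using Submodule.span_induction with
  | zero => simp
  | add x x' _ _ hx hx' => simp only [map_add, hx, hx']; abel
  | smul c x _ hx => simp only [map_smul, hx, smul_add]
  | mem x hx =>
  obtain ⟨l, rfl⟩ := hx
  simp only [lieHom_e, map_smul, LinearMap.smul_apply, smul_smul, add_assoc, add_left_comm j i l,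
    ← add_smul]
  congr 1
  push_cast
  ring

variable [CharZero k]

/-- The Lie bracket on the positive Witt algebra: `⁅e i, e j⁆ = (j - i) e (i + j)`. -/
instance : LieRing (PositiveWitt k) where
  bracket x y := lieHom k x y
  add_lie x y z := by simp
  lie_add x y z := by simp
  lie_self x := by
    have h : (2 : k) • lieHom k x x = 0 := by
      rw [two_smul]
      nth_rewrite 1 [lieHom_skew]
      exact neg_add_cancel _
    exact (smul_eq_zero.mp h).resolve_left two_ne_zero
  leibniz_lie := lieHom_leibniz k

instance : LieAlgebra k (PositiveWitt k) where
  __ := (inferInstance : Module k (PositiveWitt k))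
  lie_smul t x y := map_smul (lieHom k x) t y

end PositiveWitt

namespace SymmetricAlgebra

variable {k L : Type*} [Field k]

section Derivation

variable [AddCommGroup L] [Module k L]

/-- The algebra homomorphism `a ↦ a + D a ε` to the dual numbers, where `D` is the derivation
extending `φ`. -/
def toDual (φ : L →ₗ[k] SymmetricAlgebra k L) :
    SymmetricAlgebra k L →ₐ[k] TrivSqZeroExt (SymmetricAlgebra k L) (SymmetricAlgebra k L) :=
  lift ((TrivSqZeroExt.inlAlgHom k (SymmetricAlgebra k L) (SymmetricAlgebra k L)).toLinearMap ∘ₗ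
      ι k L +
    (TrivSqZeroExt.inrHom (SymmetricAlgebra k L) (SymmetricAlgebra k L)).restrictScalars k ∘ₗ φ)

theorem fst_toDual (φ : L →ₗ[k] SymmetricAlgebra k L) (a : SymmetricAlgebra k L) :
    (toDual φ a).fst = a := by
  have h : (TrivSqZeroExt.fstHom k (SymmetricAlgebra k L) (SymmetricAlgebra k L)).comp (toDual φ) =
      AlgHom.id k _ := by
    ext x
    simp [toDual]
  exact congr($h a)

/-- The unique derivation of the symmetric algebra that extends a given linear map on `L`. -/
def extendDerivation (φ : L →ₗ[k] SymmetricAlgebra k L) :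
    Derivation k (SymmetricAlgebra k L) (SymmetricAlgebra k L) :=
  Derivation.mk'
    ((TrivSqZeroExt.sndHom (SymmetricAlgebra k L) (SymmetricAlgebra k L)).restrictScalars k ∘ₗ
      (toDual φ).toLinearMap)
    fun a b => by simp [fst_toDual, mul_comm]

@[simp]
theorem extendDerivation_ι (φ : L →ₗ[k] SymmetricAlgebra k L) (x : L) :
    extendDerivation φ (ι k L x) = φ x := by
  simp [extendDerivation, toDual]

theorem derivation_ext {D₁ D₂ : Derivation k (SymmetricAlgebra k L) (SymmetricAlgebra k L)}
    (h : ∀ x, D₁ (ι k L x) = D₂ (ι k L x)) : D₁ = D₂ := by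
  ext a
  induction a using SymmetricAlgebra.induction with
  | algebraMap r => simp
  | ι x => exact h x
  | mul a b ha hb => simp [ha, hb]
  | add a b ha hb => simp [ha, hb]

end Derivation

variable [LieRing L] [LieAlgebra k L]

/-- The action of `L` on its symmetric algebra by derivations that extends the adjoint action. -/
def adDerivation :
    L →ₗ[k] Derivation k (SymmetricAlgebra k L) (SymmetricAlgebra k L) where
  toFun x := extendDerivation (ι k L ∘ₗ LieAlgebra.ad k L x)
  map_add' x y := derivation_ext fun z => by simp
  map_smul' c x := derivation_ext fun z => by simp

@[simp]
theorem adDerivation_ι (x y : L) :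
    adDerivation x (ι k L y) = ι k L ⁅x, y⁆ := by
  simp [adDerivation]

/-- For fixed `b`, the derivation `a ↦ {a, b}`: it sends `ι x` to `adDerivation x b`. -/
def poissonLeft (b : SymmetricAlgebra k L) :
    Derivation k (SymmetricAlgebra k L) (SymmetricAlgebra k L) :=
  extendDerivation
    { toFun := fun x => adDerivation x b
      map_add' := fun x y => by simp
      map_smul' := fun c x => by simp }

/-- The Poisson bracket `{a, b}` on the symmetric algebra of a Lie algebra: the unique biderivation
that extends the Lie bracket. -/
def poissonBracket (a b : SymmetricAlgebra k L) : SymmetricAlgebra k L := poissonLeft b a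

theorem poissonBracket_ι_left (x : L) (b : SymmetricAlgebra k L) :
    poissonBracket (ι k L x) b = adDerivation x b := by
  simp [poissonBracket, poissonLeft]

theorem poissonBracket_ι_ι (x y : L) :
    poissonBracket (ι k L x) (ι k L y) = ι k L ⁅x, y⁆ := by
  simp [poissonBracket_ι_left]

theorem poissonBracket_add_left (a b c : SymmetricAlgebra k L) :
    poissonBracket (a + b) c = poissonBracket a c + poissonBracket b c :=
  map_add (poissonLeft c) a b

theorem poissonBracket_mul_left (a b c : SymmetricAlgebra k L) :
    poissonBracket (a * b) c = a * poissonBracket b c + b * poissonBracket a c :=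
  (poissonLeft c).leibniz a b

theorem poissonBracket_algebraMap_left (r : k) (c : SymmetricAlgebra k L) :
    poissonBracket (algebraMap k _ r) c = 0 :=
  (poissonLeft c).map_algebraMap r

theorem poissonBracket_add_right (a b c : SymmetricAlgebra k L) :
    poissonBracket a (b + c) = poissonBracket a b + poissonBracket a c := by
  have h : poissonLeft (b + c) = poissonLeft b + poissonLeft c :=
    derivation_ext fun x => by simp [poissonLeft]
  exact congr($h a)

theorem poissonBracket_mul_right (a b c : SymmetricAlgebra k L) :
    poissonBracket a (b * c) = b * poissonBracket a c + c * poissonBracket a b := by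
  have h : poissonLeft (b * c) = b • poissonLeft c + c • poissonLeft b :=
    derivation_ext fun x => by simp [poissonLeft]
  exact congr($h a)

theorem poissonBracket_algebraMap_right (a : SymmetricAlgebra k L) (r : k) :
    poissonBracket a (algebraMap k _ r) = 0 := by
  have h : poissonLeft (algebraMap k (SymmetricAlgebra k L) r) = 0 :=
    derivation_ext fun x => by simp [poissonLeft]
  exact congr($h a)

theorem poissonBracket_zero_left (c : SymmetricAlgebra k L) : poissonBracket 0 c = 0 :=
  map_zero (poissonLeft c)

theorem poissonBracket_zero_right (a : SymmetricAlgebra k L) : poissonBracket a 0 = 0 := by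
  simpa using poissonBracket_algebraMap_right a 0

theorem poissonBracket_skew (a b : SymmetricAlgebra k L) :
    poissonBracket a b = -poissonBracket b a := by
  induction a using SymmetricAlgebra.induction with
  | algebraMap r => simp [poissonBracket_algebraMap_left, poissonBracket_algebraMap_right]
  | mul a a' h h' => rw [poissonBracket_mul_left, poissonBracket_mul_right, h, h']; ring
  | add a a' h h' => rw [poissonBracket_add_left, poissonBracket_add_right, h, h']; ring
  | ι x =>
  induction b using SymmetricAlgebra.induction with
  | algebraMap r => simp [poissonBracket_algebraMap_left, poissonBracket_algebraMap_right]
  | mul a a' h h' => rw [poissonBracket_mul_left, poissonBracket_mul_right, h, h']; ring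
  | add a a' h h' => rw [poissonBracket_add_left, poissonBracket_add_right, h, h']; ring
  | ι y => rw [poissonBracket_ι_ι, poissonBracket_ι_ι, ← map_neg, lie_skew]

theorem poissonBracket_jacobi (a b c : SymmetricAlgebra k L) :
    poissonBracket a (poissonBracket b c) =
      poissonBracket (poissonBracket a b) c + poissonBracket b (poissonBracket a c) := by
  induction a using SymmetricAlgebra.induction with
  | algebraMap r =>
    simp only [poissonBracket_algebraMap_left, poissonBracket_zero_left,
      poissonBracket_zero_right, add_zero]
  | mul a a' h h' =>
    simp only [poissonBracket_mul_left, poissonBracket_mul_right, poissonBracket_add_left,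
      poissonBracket_add_right, h, h', poissonBracket_skew b a, poissonBracket_skew b a']
    ring
  | add a a' h h' =>
    simp only [poissonBracket_add_left, poissonBracket_add_right, h, h']
    ring
  | ι x =>
  induction b using SymmetricAlgebra.induction with
  | algebraMap r =>
    simp only [poissonBracket_algebraMap_left, poissonBracket_algebraMap_right,
      poissonBracket_zero_left, poissonBracket_zero_right, add_zero]
  | mul a a' h h' =>
    simp only [poissonBracket_mul_left, poissonBracket_mul_right, poissonBracket_add_left,
      poissonBracket_add_right, h, h']
    ring
  | add a a' h h' =>
    simp only [poissonBracket_add_left, poissonBracket_add_right, h, h']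
    ring
  | ι y =>
  induction c using SymmetricAlgebra.induction with
  | algebraMap r =>
    simp only [poissonBracket_algebraMap_right, poissonBracket_zero_right, add_zero]
  | mul a a' h h' =>
    simp only [poissonBracket_mul_right,
      poissonBracket_add_right, h, h']
    ring
  | add a a' h h' =>
    simp only [poissonBracket_add_right, h, h']
    ring
  | ι z =>
    simp only [poissonBracket_ι_ι, ← map_add]
    rw [leibniz_lie]

/-- An ideal `I` of the symmetric algebra of a Lie algebra is Poisson if `{a, f} ∈ I` for all `a`
and all `f ∈ I`. -/
def IsPoissonIdeal (I : Ideal (SymmetricAlgebra k L)) : Prop :=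
  ∀ a : SymmetricAlgebra k L, ∀ f ∈ I, poissonBracket a f ∈ I

/-- The Poisson ideal generated by a set `X`: the smallest Poisson ideal containing `X`. -/
def poissonSpan (X : Set (SymmetricAlgebra k L)) : Ideal (SymmetricAlgebra k L) :=
  sInf {I | IsPoissonIdeal I ∧ X ⊆ I}

theorem isPoissonIdeal_poissonSpan (X : Set (SymmetricAlgebra k L)) :
    IsPoissonIdeal (poissonSpan X) := by
  intro a f hf
  simp only [poissonSpan, Submodule.mem_sInf] at hf ⊢
  exact fun I hI => hI.1 a f (hf I hI)

theorem subset_poissonSpan (X : Set (SymmetricAlgebra k L)) : X ⊆ poissonSpan X := by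
  intro f hf
  simp only [poissonSpan, SetLike.mem_coe, Submodule.mem_sInf]
  exact fun I hI => hI.2 hf

variable (k L) in
/-- The space of homogeneous elements of order `m` of the symmetric algebra: the span of the
products of `m` elements of `L`. -/
def homogeneousPart (m : ℕ) : Submodule k (SymmetricAlgebra k L) :=
  LinearMap.range (ι k L) ^ m

/-- The Poisson ideals generated by some (possibly infinite) set of quadratic elements. -/
def IsQuadraticallyGenerated (I : Ideal (SymmetricAlgebra k L)) : Prop :=
  ∃ X : Set (SymmetricAlgebra k L), X ⊆ homogeneousPart k L 2 ∧ I = poissonSpan X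

end SymmetricAlgebra

end

/-! Encode `e i * e j` as `xⁱ yʲ`. The quadratic elements of a Poisson ideal then form a subspace
`M` of `xy k[x, y]` that contains the antisymmetric polynomials divisible by `xy` and is stable
under `xⁿ(x∂x - n) + yⁿ(y∂y - n)` for `n ≥ 1`. A quadratically generated ideal is recovered from its
`M` (`le_of_quadraticPart_le`), so the claim is the chain condition for such subspaces,
`chain_stable`.

A subspace with a nonzero symmetric element `f` is large. Suitable combinations of the operators
isolate the action on one tensor factor (`leftAct_mem`), then that of `e i ⊗ e j` (`tensorAct_mem`),
then lower the order of the operator to one (`rightAct_mem`) and to zero (`mul_mem`): `M` contains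
all multiples of a nonzero polynomial. The largest ideal in `M` is preserved by `d∂x` and `d∂y` with
`d = x²y²(x - y)`; differentiating down to a nonzero constant puts a power of `d` into it
(`exists_pow_mem_core`).

Hence only a quotient of `k[x, y]` by a power of `d` matters. Splitting off the factors `x`, `y`, `x
- y` one at a time filters it with layers `k[t]`, on which `e n` acts by `tⁱ ↦ (i + a + nb) tⁱ⁺ⁿ`.
The chain condition holds in each layer by counting degrees (`densityAct_chain_stable`). -/

noncomputable section

namespace WittQuadratic

variable {k : Type*} [Field k]

/-! ### The action of `W₊` on `k[x, y]`, and lowering the order of its operators -/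

section Action

open MvPolynomial

/-- The Euler derivation `x ∂/∂x` of `k[x, y]`. -/
def dx : Derivation k (MvPolynomial (Fin 2) k) (MvPolynomial (Fin 2) k) :=
  (X 0 : MvPolynomial (Fin 2) k) • pderiv 0

/-- The Euler derivation `y ∂/∂y` of `k[x, y]`. -/
def dy : Derivation k (MvPolynomial (Fin 2) k) (MvPolynomial (Fin 2) k) :=
  (X 1 : MvPolynomial (Fin 2) k) • pderiv 1

@[simp] theorem dx_X_zero : dx (X 0 : MvPolynomial (Fin 2) k) = X 0 := by simp [dx]

@[simp] theorem dx_X_one : dx (X 1 : MvPolynomial (Fin 2) k) = 0 := by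
  simp [dx]

@[simp] theorem dy_X_zero : dy (X 0 : MvPolynomial (Fin 2) k) = 0 := by
  simp [dy]

@[simp] theorem dy_X_one : dy (X 1 : MvPolynomial (Fin 2) k) = X 1 := by simp [dy]

theorem dx_apply (f : MvPolynomial (Fin 2) k) : dx f = X 0 * pderiv 0 f := rfl

theorem dy_apply (f : MvPolynomial (Fin 2) k) : dy f = X 1 * pderiv 1 f := rfl

@[simp] theorem dx_X_zero_pow (n : ℕ) :
    dx (X 0 ^ n : MvPolynomial (Fin 2) k) = (n : MvPolynomial (Fin 2) k) * X 0 ^ n := by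
  cases n with
  | zero => simp
  | succ n =>
    simp only [Derivation.leibniz_pow, smul_eq_mul, nsmul_eq_mul, dx_X_zero,
      Nat.add_sub_cancel]
    ring

@[simp] theorem dx_X_one_pow (n : ℕ) : dx (X 1 ^ n : MvPolynomial (Fin 2) k) = 0 := by
  simp [Derivation.leibniz_pow]

@[simp] theorem dy_X_zero_pow (n : ℕ) : dy (X 0 ^ n : MvPolynomial (Fin 2) k) = 0 := by
  simp [Derivation.leibniz_pow]

@[simp] theorem dy_X_one_pow (n : ℕ) :
    dy (X 1 ^ n : MvPolynomial (Fin 2) k) = (n : MvPolynomial (Fin 2) k) * X 1 ^ n := by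
  cases n with
  | zero => simp
  | succ n =>
    simp only [Derivation.leibniz_pow, smul_eq_mul, nsmul_eq_mul, dy_X_one,
      Nat.add_sub_cancel]
    ring

theorem dx_dy (f : MvPolynomial (Fin 2) k) : dx (dy f) = dy (dx f) := by
  have h : ⁅(dx : Derivation k (MvPolynomial (Fin 2) k) (MvPolynomial (Fin 2) k)),
      (dy : Derivation k (MvPolynomial (Fin 2) k) (MvPolynomial (Fin 2) k))⁆ = 0 := by
    refine MvPolynomial.derivation_ext fun i => ?_
    fin_cases i <;> simp [Derivation.commutator_apply]
  have := congr($h f)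
  rwa [Derivation.commutator_apply, Derivation.zero_apply, sub_eq_zero] at this

/-- The action of `e n` on `S²(W₊)`, where `e i * e j` corresponds to `xⁱ yʲ`. -/
def act (n : ℕ) (f : MvPolynomial (Fin 2) k) : MvPolynomial (Fin 2) k :=
  X 0 ^ n * (dx f - (n : MvPolynomial (Fin 2) k) * f) +
    X 1 ^ n * (dy f - (n : MvPolynomial (Fin 2) k) * f)

/-- The involution of `k[x, y]` that exchanges `x` and `y`. -/
def swap : MvPolynomial (Fin 2) k →ₐ[k] MvPolynomial (Fin 2) k := rename (Equiv.swap 0 1)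

@[simp] theorem swap_X_zero : swap (X 0 : MvPolynomial (Fin 2) k) = X 1 := by simp [swap]

@[simp] theorem swap_X_one : swap (X 1 : MvPolynomial (Fin 2) k) = X 0 := by simp [swap]

@[simp] theorem swap_swap (f : MvPolynomial (Fin 2) k) : swap (swap f) = f := by
  simp [swap, rename_rename, ← Equiv.coe_trans]

theorem swap_dx (f : MvPolynomial (Fin 2) k) : swap (dx f) = dy (swap f) := by
  induction f using MvPolynomial.induction_on with
  | C a => simp [← MvPolynomial.algebraMap_eq]
  | add p q hp hq => simp [hp, hq]
  | mul_X p i hp => fin_cases i <;> simp [hp]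

theorem polynomial_induction {P : MvPolynomial (Fin 2) k → Prop}
    (hadd : ∀ f g, P f → P g → P (f + g)) (hsmul : ∀ (c : k) f, P f → P (c • f))
    (hmon : ∀ p q, P (X 0 ^ p * X 1 ^ q)) (f : MvPolynomial (Fin 2) k) : P f := by
  induction f using MvPolynomial.induction_on' with
  | monomial u a =>
    have : monomial u a = a • (X 0 ^ u 0 * X 1 ^ u 1 : MvPolynomial (Fin 2) k) := by
      rw [MvPolynomial.monomial_eq, Finsupp.prod_fintype _ _ (by simp), Fin.prod_univ_two,
        MvPolynomial.smul_eq_C_mul]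
    rw [this]
    exact hsmul _ _ (hmon _ _)
  | add p q hp hq => exact hadd _ _ hp hq

/-- The linear extension in `c` of `(xⁱ yʲ) ↦ (e i ⊗ e j) f`. -/
def tensorAct (f c : MvPolynomial (Fin 2) k) : MvPolynomial (Fin 2) k :=
  c * dx (dy f) - dx c * dy f - dy c * dx f + dx (dy c) * f

/-- The linear extension in `c` of `(xⁱ yʲ) ↦ xⁱ (1 ⊗ e j) f`. -/
def rightAct (f c : MvPolynomial (Fin 2) k) : MvPolynomial (Fin 2) k :=
  c * dy f - dy c * f

section Stages

variable {M : Submodule k (MvPolynomial (Fin 2) k)}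

/-- For symmetric `f`, `act n f` is the left half plus its mirror image, while `M` contains the left
half minus its mirror image. Adding gives twice the left half. -/
theorem leftAct_mem [CharZero k] (hact : ∀ n, 1 ≤ n → ∀ f ∈ M, act n f ∈ M)
    (hswap : ∀ f, X 0 * X 1 ∣ f → f - swap f ∈ M) {f : MvPolynomial (Fin 2) k} (hf : f ∈ M)
    (hfs : swap f = f) (hdvd : X 0 * X 1 ∣ f) {n : ℕ} (hn : 1 ≤ n) :
    X 0 ^ n * (dx f - (n : MvPolynomial (Fin 2) k) * f) ∈ M := by
  have hsw : swap (X 0 ^ n * (dx f - (n : MvPolynomial (Fin 2) k) * f)) =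
      X 1 ^ n * (dy f - (n : MvPolynomial (Fin 2) k) * f) := by
    simp [swap_dx, hfs]
  have h1 := hact n hn f hf
  have h2 : X 0 ^ n * (dx f - (n : MvPolynomial (Fin 2) k) * f) -
      swap (X 0 ^ n * (dx f - (n : MvPolynomial (Fin 2) k) * f)) ∈ M := by
    refine hswap _ ?_
    obtain ⟨h, rfl⟩ := hdvd
    exact ⟨X 0 ^ n * (h + dx h - (n : MvPolynomial (Fin 2) k) * h), by
      simp [Derivation.leibniz]; ring⟩
  rw [hsw] at h2
  have h3 : (2 : k) • (X 0 ^ n * (dx f - (n : MvPolynomial (Fin 2) k) * f)) ∈ M := by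
    convert M.add_mem h1 h2 using 1
    rw [act, two_smul]
    ring
  exact (M.smul_mem_iff two_ne_zero).1 h3

theorem tensorAct_mem (hact : ∀ n, 1 ≤ n → ∀ f ∈ M, act n f ∈ M)
    {f : MvPolynomial (Fin 2) k}
    (h : ∀ n : ℕ, 1 ≤ n → X 0 ^ n * (dx f - (n : MvPolynomial (Fin 2) k) * f) ∈ M)
    (m : MvPolynomial (Fin 2) k) :
    tensorAct f (X 0 * X 1 * (X 0 - X 1) ^ 3 * m) ∈ M := by
  induction m using polynomial_induction with
  | hadd a b ha hb =>
    convert M.add_mem ha hb using 1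
    simp only [tensorAct, mul_add, map_add]; ring
  | hsmul c a ha =>
    convert M.smul_mem c ha using 1
    simp only [tensorAct, mul_smul_comm, Derivation.map_smul, smul_mul_assoc, smul_add, smul_sub]
  | hmon p q =>
    have key : ∀ i j : ℕ, 1 ≤ i → 1 ≤ j →
        act j (X 0 ^ i * (dx f - (i : MvPolynomial (Fin 2) k) * f)) ∈ M :=
      fun i j hi hj => hact j hj _ (h i hi)
    -- Applying `e j` to `(e i ⊗ 1) f` gives `(e i ⊗ e j) f` plus `xⁱ⁺ʲ (dx + i - j)(dx - i) f`. For
    -- fixed `i + j` the latter is quadratic in `i`, so a third difference kills it; the weights 1,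
    -- -3, 3, -1 are the source of `(x - y)³`.
    convert M.sub_mem (M.add_mem (key (p + 4) (q + 1) (by omega) (by omega))
      (M.smul_mem 3 (key (p + 2) (q + 3) (by omega) (by omega))))
      (M.add_mem (key (p + 1) (q + 4) (by omega) (by omega))
      (M.smul_mem 3 (key (p + 3) (q + 2) (by omega) (by omega)))) using 1
    have e : X 0 * X 1 * (X 0 - X 1) ^ 3 * (X 0 ^ p * X 1 ^ q) =
      (X 0 ^ (p + 4) * X 1 ^ (q + 1) - 3 * (X 0 ^ (p + 3) * X 1 ^ (q + 2)) +
        3 * (X 0 ^ (p + 2) * X 1 ^ (q + 3)) - X 0 ^ (p + 1) * X 1 ^ (q + 4) :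
          MvPolynomial (Fin 2) k) := by ring
    have h3 (g : MvPolynomial (Fin 2) k) : (3 : k) • g = 3 * g := by
      rw [MvPolynomial.smul_eq_C_mul, map_ofNat C 3]
    rw [e]
    have d3 : dx (3 : MvPolynomial (Fin 2) k) = 0 := dx.map_natCast 3
    have d3' : dy (3 : MvPolynomial (Fin 2) k) = 0 := dy.map_natCast 3
    simp only [tensorAct, act, h3, Derivation.leibniz, smul_eq_mul, map_add, map_sub,
      dx_X_zero_pow, dx_X_one_pow, dy_X_zero_pow, dy_X_one_pow, d3, d3', Derivation.map_natCast,
      mul_zero, add_zero, zero_add, ← dx_dy]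
    push_cast
    ring

theorem rightAct_mem [CharZero k] (hact : ∀ n, 1 ≤ n → ∀ f ∈ M, act n f ∈ M)
    {f w : MvPolynomial (Fin 2) k}
    (h : ∀ m, tensorAct f (w * m) ∈ M) (m : MvPolynomial (Fin 2) k) :
    rightAct f (X 0 ^ 3 * (X 0 - X 1) ^ 3 * w * m) ∈ M := by
  have key (n : ℕ) (a : MvPolynomial (Fin 2) k) (hn : 1 ≤ n) :
      act n (tensorAct f (a * (w * m))) ∈ M := by
    have := hact n hn _ (h (a * m))
    rwa [mul_left_comm] at this
  -- The coefficients `aₙ` are those of `A(z) = ∑ aₙ zⁿ = z(z - x)²(z - y)³`. In the sum of `act n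
  -- (tensorAct f (aₙ v))` with `v = w * m`, the factor `n` acts as `z∂z`, followed by `z = x` in
  -- the left half and `z = y` in the right half. Each half differentiates `A` at most twice in `z`
  -- and its own variable. The triple zero kills the right half; in the left half only `-dx² + z∂z
  -- dx` survives, with value `-4x³(x - y)³` on `A`.
  have hsum := M.add_mem (M.add_mem (M.add_mem (M.add_mem (M.add_mem
    (key 1 (-(X 0 ^ 2 * X 1 ^ 3)) le_rfl)
    (key 2 (2 * X 0 * X 1 ^ 3 + 3 * X 0 ^ 2 * X 1 ^ 2) (by norm_num)))
    (key 3 (-X 1 ^ 3 - 6 * X 0 * X 1 ^ 2 - 3 * X 0 ^ 2 * X 1) (by norm_num)))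
    (key 4 (3 * X 1 ^ 2 + 6 * X 0 * X 1 + X 0 ^ 2) (by norm_num)))
    (key 5 (-3 * X 1 - 2 * X 0) (by norm_num)))
    (key 6 1 (by norm_num))
  refine (M.smul_mem_iff (by norm_num : (-4 : k) ≠ 0)).1 ?_
  convert hsum using 1
  have h4 (g : MvPolynomial (Fin 2) k) : (-4 : k) • g = -4 * g := by
    rw [MvPolynomial.smul_eq_C_mul, map_neg, map_ofNat C 4]
  rw [h4, mul_assoc _ w m]
  generalize w * m = v
  have dx2 : dx (2 : MvPolynomial (Fin 2) k) = 0 := dx.map_natCast 2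
  have dy2 : dy (2 : MvPolynomial (Fin 2) k) = 0 := dy.map_natCast 2
  have dx3 : dx (3 : MvPolynomial (Fin 2) k) = 0 := dx.map_natCast 3
  have dy3 : dy (3 : MvPolynomial (Fin 2) k) = 0 := dy.map_natCast 3
  have dx6 : dx (6 : MvPolynomial (Fin 2) k) = 0 := dx.map_natCast 6
  have dy6 : dy (6 : MvPolynomial (Fin 2) k) = 0 := dy.map_natCast 6
  simp only [tensorAct, rightAct, act, Derivation.leibniz, Derivation.leibniz_pow, smul_eq_mul,
    map_add, map_sub, map_neg, nsmul_eq_mul, dx_X_zero, dx_X_one, dy_X_zero, dy_X_one,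
    dx2, dy2, dx3, dy3, dx6, dy6, Derivation.map_one_eq_zero,
    map_zero, mul_zero, Nat.cast_ofNat, Nat.cast_one,
    Nat.reduceSub, pow_one, add_zero, zero_add, ← dx_dy]
  ring

theorem mul_mem [CharZero k] (hact : ∀ n, 1 ≤ n → ∀ f ∈ M, act n f ∈ M)
    {f w : MvPolynomial (Fin 2) k}
    (h : ∀ m, rightAct f (w * m) ∈ M) (m : MvPolynomial (Fin 2) k) :
    X 1 ^ 3 * (X 0 - X 1) ^ 2 * w * f * m ∈ M := by
  have key (n : ℕ) (a : MvPolynomial (Fin 2) k) (hn : 1 ≤ n) :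
      act n (rightAct f (a * (w * m))) ∈ M := by
    have := hact n hn _ (h (a * m))
    rwa [mul_left_comm] at this
  -- The same device with `A(z) = z(z - x)²(z - y)²`. The left half now differentiates only once in
  -- `z` and `x`, so it vanishes; the right half leaves `(-dy² + z∂z dy) A = -4y³(x - y)²` at `z =
  -- y`, times `v * f`.
  have hsum := M.add_mem (M.add_mem (M.add_mem (M.add_mem
    (key 1 (X 0 ^ 2 * X 1 ^ 2) le_rfl)
    (key 2 (-2 * X 0 * X 1 ^ 2 - 2 * X 0 ^ 2 * X 1) (by norm_num)))
    (key 3 (X 0 ^ 2 + 4 * X 0 * X 1 + X 1 ^ 2) (by norm_num)))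
    (key 4 (-2 * X 0 - 2 * X 1) (by norm_num)))
    (key 5 1 (by norm_num))
  refine (M.smul_mem_iff (by norm_num : (-4 : k) ≠ 0)).1 ?_
  convert hsum using 1
  have h4 (g : MvPolynomial (Fin 2) k) : (-4 : k) • g = -4 * g := by
    rw [MvPolynomial.smul_eq_C_mul, map_neg, map_ofNat C 4]
  have e : X 1 ^ 3 * (X 0 - X 1) ^ 2 * w * f * m =
      X 1 ^ 3 * (X 0 - X 1) ^ 2 * (w * m) * f := by ring
  rw [h4, e]
  generalize w * m = v
  have dx2 : dx (2 : MvPolynomial (Fin 2) k) = 0 := dx.map_natCast 2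
  have dy2 : dy (2 : MvPolynomial (Fin 2) k) = 0 := dy.map_natCast 2
  have dx4 : dx (4 : MvPolynomial (Fin 2) k) = 0 := dx.map_natCast 4
  have dy4 : dy (4 : MvPolynomial (Fin 2) k) = 0 := dy.map_natCast 4
  simp only [rightAct, act, Derivation.leibniz, Derivation.leibniz_pow, smul_eq_mul,
    map_add, map_sub, map_neg, nsmul_eq_mul, dx_X_zero, dx_X_one, dy_X_zero, dy_X_one,
    dx2, dy2, dx4, dy4, Derivation.map_one_eq_zero,
    map_zero, mul_zero, Nat.cast_ofNat, Nat.cast_one,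
    Nat.reduceSub, pow_one, add_zero, zero_add]
  ring

end Stages

end Action

/-! ### The largest ideal in a stable subspace contains a power of `x²y²(x - y)` -/

section Core

open MvPolynomial

/-- The largest ideal of `k[x, y]` contained in a subspace `M`. -/
def core (M : Submodule k (MvPolynomial (Fin 2) k)) : Ideal (MvPolynomial (Fin 2) k) where
  carrier := {f | ∀ g, f * g ∈ M}
  add_mem' := fun ha hb g => by rw [add_mul]; exact M.add_mem (ha g) (hb g)
  zero_mem' := fun g => by rw [zero_mul]; exact M.zero_mem
  smul_mem' := fun c a ha g => by
    rw [smul_eq_mul, mul_comm c, mul_assoc]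
    exact ha _

variable {M : Submodule k (MvPolynomial (Fin 2) k)}

theorem mul_mem_core [CharZero k] (hact : ∀ n, 1 ≤ n → ∀ f ∈ M, act n f ∈ M)
    (hswap : ∀ f, X 0 * X 1 ∣ f → f - swap f ∈ M) {f : MvPolynomial (Fin 2) k} (hf : f ∈ M)
    (hfs : swap f = f) (hdvd : X 0 * X 1 ∣ f) :
    X 1 ^ 3 * (X 0 - X 1) ^ 2 *
      (X 0 ^ 3 * (X 0 - X 1) ^ 3 * (X 0 * X 1 * (X 0 - X 1) ^ 3)) * f ∈ core M :=
  mul_mem hact (rightAct_mem hact (tensorAct_mem hact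
    fun _ hn => leftAct_mem hact hswap hf hfs hdvd hn))

/-- `act n` is the vector field `xⁿ dx + yⁿ dy` plus a multiplication operator, so `act n (f * g) -
f * act n g` is the vector field applied to `f`, times `g`. -/
theorem vectorField_mem_core (hact : ∀ n, 1 ≤ n → ∀ f ∈ M, act n f ∈ M) {n : ℕ} (hn : 1 ≤ n)
    {f : MvPolynomial (Fin 2) k} (hf : f ∈ core M) :
    X 0 ^ n * dx f + X 1 ^ n * dy f ∈ core M := by
  intro g
  have h1 := hact n hn _ (hf g)
  have h2 := hf (X 0 ^ n * (dx g - (n : MvPolynomial (Fin 2) k) * g) +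
    X 1 ^ n * (dy g - (n : MvPolynomial (Fin 2) k) * g))
  convert M.sub_mem h1 h2 using 1
  simp only [act, Derivation.leibniz, smul_eq_mul]
  ring

/-- Eliminating one of the two partial derivatives between the vector fields for `n = 1` and `n = 2`
leaves `x²(x - y)∂x` or `y²(x - y)∂y`. -/
theorem mul_pderiv_mem_core (hact : ∀ n, 1 ≤ n → ∀ f ∈ M, act n f ∈ M)
    {f : MvPolynomial (Fin 2) k} (hf : f ∈ core M) (i : Fin 2) :
    X 0 ^ 2 * X 1 ^ 2 * (X 0 - X 1) * pderiv i f ∈ core M := by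
  have h1 := vectorField_mem_core hact le_rfl hf
  have h2 := vectorField_mem_core hact one_le_two hf
  rw [dx_apply, dy_apply] at h1 h2
  fin_cases i
  · convert (core M).mul_mem_left (X 1 ^ 2)
      ((core M).sub_mem h2 ((core M).mul_mem_left (X 1) h1)) using 1
    simp only [Fin.zero_eta]
    ring
  · convert (core M).mul_mem_left (X 0 ^ 2)
      ((core M).sub_mem ((core M).mul_mem_left (X 0) h1) h2) using 1
    simp only [Fin.mk_one]
    ring

theorem exists_pderiv_ne_zero {σ : Type*} [CharZero k] {f : MvPolynomial σ k}
    (hf : f.totalDegree ≠ 0) :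
    ∃ i, pderiv i f ≠ 0 := by
  classical
  rw [Ne, MvPolynomial.totalDegree_eq_zero_iff] at hf
  push Not at hf
  obtain ⟨m, hm, i, hi⟩ := hf
  refine ⟨i, fun h => ?_⟩
  have h1 := MvPolynomial.coeff_pderiv (i := i) f (m - Finsupp.single i 1)
  have h2 : m - Finsupp.single i 1 + Finsupp.single i 1 = m :=
    tsub_add_cancel_of_le (Finsupp.single_le_iff.2 (Nat.one_le_iff_ne_zero.2 hi))
  rw [h, MvPolynomial.coeff_zero, h2] at h1
  rcases mul_eq_zero.1 h1.symm with h3 | h3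
  · exact MvPolynomial.mem_support_iff.1 hm h3
  · exact Nat.cast_add_one_ne_zero _ h3

theorem totalDegree_pderiv_lt {σ : Type*} {f : MvPolynomial σ k}
    (hf : f.totalDegree ≠ 0) (i : σ) : (pderiv i f).totalDegree < f.totalDegree := by
  classical
  rw [MvPolynomial.totalDegree, Finset.sup_lt_iff (Nat.pos_of_ne_zero hf)]
  intro m hm
  rw [MvPolynomial.mem_support_iff, MvPolynomial.coeff_pderiv] at hm
  have h := MvPolynomial.le_totalDegree (MvPolynomial.mem_support_iff.2 (left_ne_zero_of_mul hm))
  rw [Finsupp.sum_add_index' (by simp) (by simp), Finsupp.sum_single_index rfl] at h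
  omega

/-- Modulo `J`, `d ∂(dⁿ f)` equals `dⁿ⁺¹ ∂f`. So `f` may be replaced by a nonzero partial
derivative, at the cost of one factor `d`, until it is a nonzero constant. -/
theorem exists_pow_mem_of_mul_pderiv_mem {σ : Type*} [CharZero k] {J : Ideal (MvPolynomial σ k)}
    {d : MvPolynomial σ k} (hJ : ∀ f ∈ J, ∀ i, d * pderiv i f ∈ J) {f : MvPolynomial σ k}
    (hf : f ≠ 0) {n : ℕ} (hfJ : d ^ n * f ∈ J) : ∃ N, d ^ N ∈ J := by
  induction h : f.totalDegree using Nat.strong_induction_on generalizing f n with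
  | _ D ih =>
  by_cases h0 : f.totalDegree = 0
  · rw [MvPolynomial.totalDegree_eq_zero_iff_eq_C] at h0
    rw [h0] at hf hfJ
    refine ⟨n, ?_⟩
    have hc : f.coeff 0 ≠ 0 := fun h => hf (by rw [h, map_zero])
    have := J.mul_mem_right (C (f.coeff 0)⁻¹) hfJ
    rwa [mul_assoc, ← map_mul, mul_inv_cancel₀ hc, map_one, mul_one] at this
  · obtain ⟨i, hi⟩ := exists_pderiv_ne_zero h0
    refine ih _ (h ▸ totalDegree_pderiv_lt h0 i) hi (n := n + 1) ?_ rfl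
    have h1 := hJ _ hfJ i
    cases n with
    | zero => simpa using h1
    | succ n =>
      have h2 := J.mul_mem_left ((n + 1 : MvPolynomial σ k) * pderiv i d) hfJ
      convert J.sub_mem h1 h2 using 1
      rw [MvPolynomial.pderiv_mul, MvPolynomial.pderiv_pow]
      push_cast [Nat.add_sub_cancel]
      ring

/-- A Witt-stable subspace with a nonzero symmetric element, containing the antisymmetric
polynomials divisible by `xy`, contains an ideal generated by a power of `x²y²(x - y)`. -/
theorem exists_pow_mem_core [CharZero k] (hact : ∀ n, 1 ≤ n → ∀ f ∈ M, act n f ∈ M)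
    (hswap : ∀ f, X 0 * X 1 ∣ f → f - swap f ∈ M) {f : MvPolynomial (Fin 2) k} (hf : f ∈ M)
    (hfs : swap f = f) (hdvd : X 0 * X 1 ∣ f) (hf0 : f ≠ 0) :
    ∃ N, (X 0 ^ 2 * X 1 ^ 2 * (X 0 - X 1)) ^ N ∈ core M := by
  have hne : (X 0 - X 1 : MvPolynomial (Fin 2) k) ≠ 0 :=
    sub_ne_zero.2 fun h => zero_ne_one (MvPolynomial.X_injective h)
  refine exists_pow_mem_of_mul_pderiv_mem (n := 0)
    (fun f hf i => mul_pderiv_mem_core hact hf i) (mul_ne_zero ?_ hf0)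
    (by simpa using mul_mem_core hact hswap hf hfs hdvd)
  simp [hne, MvPolynomial.X_ne_zero]

end Core

/-! ### The chain condition for tensor density modules on `k[t]` -/

section DensityModules

open Polynomial

theorem exists_stable_of_finite_diff (S : ℕ → Set ℕ) (hS : Monotone S) (n₀ : ℕ)
    (hfin : ((⋃ n, S n) \ S n₀).Finite) : ∃ N, ∀ n, N ≤ n → S n = S N := by
  have hex : ∀ i ∈ (⋃ n, S n) \ S n₀, ∃ n, i ∈ S n := fun i hi => Set.mem_iUnion.1 hi.1
  choose! g hg using hex
  refine ⟨max n₀ (hfin.toFinset.sup g), fun n hn => Set.Subset.antisymm (fun i hi => ?_) (hS hn)⟩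
  by_cases h : i ∈ S n₀
  · exact hS (le_max_left _ _) h
  · have hi' : i ∈ (⋃ n, S n) \ S n₀ := ⟨Set.mem_iUnion.2 ⟨n, hi⟩, h⟩
    exact hS (le_max_of_le_right (Finset.le_sup (f := g) (hfin.mem_toFinset.2 hi'))) (hg i hi')

/-- Cancelling leading terms against elements of `P` brings any element of `Q` down to zero. -/
theorem eq_of_natDegree_image_eq {P Q : Submodule k k[X]} (hPQ : P ≤ Q)
    (h : ∀ q ∈ Q, q ≠ 0 → ∃ p ∈ P, p ≠ 0 ∧ p.natDegree = q.natDegree) : P = Q := by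
  refine le_antisymm hPQ fun q hq => ?_
  induction hd : q.degree using WellFoundedLT.induction generalizing q with
  | _ d ih =>
  by_cases h0 : q = 0
  · rw [h0]; exact P.zero_mem
  obtain ⟨p, hp, hp0, hpq⟩ := h q hq h0
  have hc : q.leadingCoeff / p.leadingCoeff ≠ 0 :=
    div_ne_zero (leadingCoeff_ne_zero.2 h0) (leadingCoeff_ne_zero.2 hp0)
  have hr : (q - (q.leadingCoeff / p.leadingCoeff) • p).degree < q.degree := by
    refine degree_sub_lt_left ?_ h0 ?_
    · rw [degree_smul_of_smul_regular _ (IsSMulRegular.of_ne_zero hc),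
        degree_eq_natDegree h0, degree_eq_natDegree hp0, hpq]
    · rw [smul_eq_C_mul, leadingCoeff_mul, leadingCoeff_C,
        div_mul_cancel₀ _ (leadingCoeff_ne_zero.2 hp0)]
  have := ih _ (hd ▸ hr) _ (Q.sub_mem hq (Q.smul_mem _ (hPQ hp))) rfl
  simpa using P.add_mem this (P.smul_mem (q.leadingCoeff / p.leadingCoeff) hp)

/-- The action of `e n` on a module of tensor densities:
`tⁱ ↦ (i + a + n b) tⁱ⁺ⁿ`. -/
def densityAct (a b : k) (n : ℕ) (p : k[X]) : k[X] :=
  X ^ n * (X * derivative p + C (a + n * b) * p)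

theorem coeff_densityAct (a b : k) (n : ℕ) (p : k[X]) (i : ℕ) :
    (densityAct a b n p).coeff (i + n) = (i + a + n * b) * p.coeff i := by
  rw [densityAct, mul_comm, coeff_mul_X_pow, coeff_add, coeff_C_mul]
  cases i with
  | zero => simp
  | succ i => rw [coeff_X_mul, coeff_derivative]; push_cast; ring

theorem natDegree_densityAct {a b : k} {n : ℕ} {p : k[X]} (hp : p ≠ 0)
    (h : (p.natDegree + a + n * b : k) ≠ 0) :
    (densityAct a b n p).natDegree = p.natDegree + n := by
  refine natDegree_eq_of_le_of_coeff_ne_zero ?_ ?_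
  · rw [densityAct]
    refine natDegree_mul_le.trans ?_
    rw [natDegree_X_pow, add_comm]
    gcongr
    refine natDegree_add_le_of_degree_le ?_ (natDegree_C_mul_le _ _)
    rcases Nat.eq_zero_or_pos p.natDegree with h0 | h0
    · rw [derivative_of_natDegree_zero h0, mul_zero, natDegree_zero]
      exact Nat.zero_le _
    · refine natDegree_mul_le.trans ?_
      have := natDegree_derivative_lt h0.ne'
      rw [natDegree_X]
      omega
  · rw [coeff_densityAct]
    exact mul_ne_zero h (leadingCoeff_ne_zero.2 hp)

/-- A subspace is tracked by the degrees of its nonzero elements. An element of degree `i` yields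
every degree `i + n` for which `i + a + nb ≠ 0`, and this fails for at most one `n` unless `b = 0`
and `i = -a`. So the degrees occurring later in the chain add only finitely many. -/
theorem densityAct_chain_stable [CharZero k] (a b : k) (P : ℕ → Submodule k k[X])
    (hmono : Monotone P) (hP : ∀ m n, 1 ≤ n → ∀ p ∈ P m, densityAct a b n p ∈ P m) :
    ∃ N, ∀ n, N ≤ n → P n = P N := by
  let S : ℕ → Set ℕ := fun n => {i | ∃ p ∈ P n, p ≠ 0 ∧ p.natDegree = i}
  have hS : Monotone S := fun m n hmn i ⟨p, hp, h⟩ => ⟨p, hmono hmn hp, h⟩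
  have hfin : ∃ n₀, ((⋃ n, S n) \ S n₀).Finite := by
    by_cases hex : ∃ i m, i ∈ S m ∧ ((i : k) + a ≠ 0 ∨ b ≠ 0)
    · obtain ⟨i, m, ⟨p, hp, hp0, rfl⟩, hi⟩ := hex
      refine ⟨m, ?_⟩
      have hbad : {n : ℕ | (p.natDegree + a + n * b : k) = 0}.Finite := by
        refine Set.Subsingleton.finite fun n hn n' hn' => ?_
        simp only [Set.mem_ofPred_eq] at hn hn'
        have hb : b ≠ 0 := by
          rintro rfl
          simp only [mul_zero, add_zero] at hn
          simp [hn] at hi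
        have : (n : k) * b = n' * b := by linear_combination hn - hn'
        exact_mod_cast mul_right_cancel₀ hb this
      refine ((Set.finite_le_nat p.natDegree).union
        (hbad.image fun n => p.natDegree + n)).subset fun j hj => ?_
      by_cases hle : j ≤ p.natDegree
      · exact Or.inl hle
      obtain ⟨n, rfl⟩ := Nat.exists_eq_add_of_le (not_le.1 hle).le
      refine Or.inr ⟨n, ?_, rfl⟩
      by_contra hn
      have hd := natDegree_densityAct hp0 hn
      refine hj.2 ⟨_, hP m n (by omega) p hp, ?_, hd⟩
      rintro h0
      rw [h0, natDegree_zero] at hd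
      omega
    -- In the exceptional case every degree that occurs equals `-a`, so there is at most one.
    · push Not at hex
      refine ⟨0, Set.Subsingleton.finite fun i hi j hj => ?_⟩
      obtain ⟨m, hm⟩ := Set.mem_iUnion.1 hi.1
      obtain ⟨n, hn⟩ := Set.mem_iUnion.1 hj.1
      have : (i : k) = j := by linear_combination (hex i m hm).1 - (hex j n hn).1
      exact_mod_cast this
  obtain ⟨n₀, h₀⟩ := hfin
  obtain ⟨N, hN⟩ := exists_stable_of_finite_diff S hS n₀ h₀
  refine ⟨N, fun n hn => (eq_of_natDegree_image_eq (hmono hn) fun q hq hq0 => ?_).symm⟩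
  have : q.natDegree ∈ S n := ⟨q, hq, hq0, rfl⟩
  rw [hN n hn] at this
  exact this

end DensityModules

/-! ### Filtration by `xᵖ y^q (x - y)ʳ` and the chain condition in `k[x, y]` -/

section Chains

open MvPolynomial

/-- For a chain `M`, the subspaces of multiples of `D` in the members of `M` stabilise. -/
def StableAlong (M : ℕ → Submodule k (MvPolynomial (Fin 2) k)) (D : MvPolynomial (Fin 2) k) :
    Prop :=
  ∃ N, ∀ n, N ≤ n → ∀ g, D * g ∈ M n → D * g ∈ M N

/-- An extension argument: `ρ` restricts to the line `l = 0`, so it identifies the layer between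
multiples of `D` and of `D * l` with a subspace of a density module. The chain stabilises on that
layer and, by hypothesis, below it. -/
theorem stableAlong_of_mul {M : ℕ → Submodule k (MvPolynomial (Fin 2) k)} [CharZero k]
    (hmono : Monotone M) (hact : ∀ m n, 1 ≤ n → ∀ f ∈ M m, act n f ∈ M m)
    {D l : MvPolynomial (Fin 2) k} (ρ : MvPolynomial (Fin 2) k →ₐ[k] Polynomial k)
    (hker : ∀ g, ρ g = 0 → l ∣ g) (a b : k)
    (hρ : ∀ n, 1 ≤ n → ∀ g, ∃ h, act n (D * g) = D * h ∧ ρ h = densityAct a b n (ρ g))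
    (hstab : StableAlong M (D * l)) : StableAlong M D := by
  let Q : ℕ → Submodule k (MvPolynomial (Fin 2) k) :=
    fun n => (M n).comap (LinearMap.mulLeft k D)
  have hQ : ∀ n g, g ∈ Q n ↔ D * g ∈ M n := fun n g => Iff.rfl
  obtain ⟨N₁, hN₁⟩ := densityAct_chain_stable a b (fun n => (Q n).map ρ.toLinearMap)
    (fun m n hmn => Submodule.map_mono (Submodule.comap_mono (hmono hmn)))
    (by
      rintro m n hn _ ⟨g, hg, rfl⟩
      obtain ⟨h, h1, h2⟩ := hρ n hn g
      refine ⟨h, ?_, h2⟩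
      rw [SetLike.mem_coe, hQ, ← h1]
      exact hact m n hn _ hg)
  obtain ⟨N₂, hN₂⟩ := hstab
  refine ⟨max N₁ N₂, fun n hn g hg => ?_⟩
  have h1 : ρ g ∈ (Q N₁).map ρ.toLinearMap := by
    rw [← hN₁ n (le_of_max_le_left hn)]
    exact ⟨g, hg, rfl⟩
  obtain ⟨g', hg', h⟩ := h1
  have hg'' : D * g' ∈ M N₁ := hg'
  obtain ⟨w, hw⟩ := hker (g - g') (by rw [map_sub, sub_eq_zero]; exact h.symm)
  have e : D * g = D * g' + D * l * w := by
    rw [mul_assoc, ← hw]; ring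
  have h2 : D * l * w ∈ M n := by
    have := (M n).sub_mem hg (hmono (le_of_max_le_left hn) hg'')
    rwa [e, add_sub_cancel_left] at this
  rw [e]
  exact (M _).add_mem (hmono (le_max_left _ _) hg'')
    (hmono (le_max_right _ _) (hN₂ n (le_of_max_le_right hn) w h2))

/-- Used with `φ` the restriction to the line `l = 0` followed by a section: if the restriction of
`g` vanishes, then `l ∣ g`. -/
theorem dvd_sub_section {l : MvPolynomial (Fin 2) k}
    (φ : MvPolynomial (Fin 2) k →ₐ[k] MvPolynomial (Fin 2) k)
    (h : ∀ i, l ∣ X i - φ (X i)) (g : MvPolynomial (Fin 2) k) : l ∣ g - φ g := by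
  induction g using MvPolynomial.induction_on with
  | C a => simp [← MvPolynomial.algebraMap_eq]
  | add p q hp hq =>
    rw [map_add, add_sub_add_comm]
    exact dvd_add hp hq
  | mul_X p i hp =>
    have e : p * X i - φ (p * X i) = (p - φ p) * X i + φ p * (X i - φ (X i)) := by
      rw [map_mul]; ring
    rw [e]
    exact dvd_add (hp.mul_right _) ((h i).mul_left _)

/-- The condition `hu` says that each `u i` is a scalar multiple of `t`, so this is restriction to a
line through the origin, where the Euler field becomes `t d/dt`. -/
theorem aeval_euler (u : Fin 2 → Polynomial k)
    (hu : ∀ i, Polynomial.X * Polynomial.derivative (u i) = u i) (g : MvPolynomial (Fin 2) k) :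
    aeval u (dx g) + aeval u (dy g) = Polynomial.X * Polynomial.derivative (aeval u g) := by
  induction g using MvPolynomial.induction_on with
  | C a => simp [← MvPolynomial.algebraMap_eq, Polynomial.algebraMap_eq]
  | add p q hp hq =>
    simp only [map_add, mul_add, ← hp, ← hq]
    ring
  | mul_X p i hp =>
    have hi := hu i
    fin_cases i
    all_goals
      simp only [Fin.zero_eta, Fin.mk_one] at hi ⊢
      simp only [Derivation.leibniz, smul_eq_mul, dx_X_zero, dx_X_one, dy_X_zero, dy_X_one,
        map_mul, map_add, aeval_X, map_zero, Polynomial.derivative_mul]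
    · linear_combination u 0 * hp - aeval u p * hi
    · linear_combination u 1 * hp - aeval u p * hi

/-- Each of `x`, `y`, `x - y` divides its image under the vector field; for `x - y` the cofactor is
`(xⁿ⁺¹ - yⁿ⁺¹)/(x - y)`. This is why the filtration is stable. -/
theorem vectorField_monomial (p q r n : ℕ) :
    X 0 ^ n * dx (X 0 ^ p * X 1 ^ q * (X 0 - X 1) ^ r : MvPolynomial (Fin 2) k) +
      X 1 ^ n * dy (X 0 ^ p * X 1 ^ q * (X 0 - X 1) ^ r : MvPolynomial (Fin 2) k) =
    X 0 ^ p * X 1 ^ q * (X 0 - X 1) ^ r *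
      ((p : MvPolynomial (Fin 2) k) * X 0 ^ n + (q : MvPolynomial (Fin 2) k) * X 1 ^ n +
        (r : MvPolynomial (Fin 2) k) *
          ∑ i ∈ Finset.range (n + 1), X 0 ^ i * X 1 ^ (n + 1 - 1 - i)) := by
  have hG := (Commute.all (X 0 : MvPolynomial (Fin 2) k) (X 1)).geom_sum₂_mul (n + 1)
  generalize ∑ i ∈ Finset.range (n + 1), (X 0 : MvPolynomial (Fin 2) k) ^ i *
    X 1 ^ (n + 1 - 1 - i) = G at hG ⊢
  cases r with
  | zero =>
    simp only [pow_zero, mul_one, Derivation.leibniz, smul_eq_mul, dx_X_zero_pow, dx_X_one_pow,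
      dy_X_zero_pow, dy_X_one_pow, Nat.cast_zero]
    ring
  | succ r =>
    have hdx : dx ((X 0 - X 1) ^ (r + 1) : MvPolynomial (Fin 2) k) =
        (r + 1 : MvPolynomial (Fin 2) k) * (X 0 - X 1) ^ r * X 0 := by
      simp [Derivation.leibniz_pow, mul_assoc]
    have hdy : dy ((X 0 - X 1) ^ (r + 1) : MvPolynomial (Fin 2) k) =
        -((r + 1 : MvPolynomial (Fin 2) k) * (X 0 - X 1) ^ r * X 1) := by
      simp [Derivation.leibniz_pow, mul_assoc]
    simp only [Derivation.leibniz, smul_eq_mul, hdx, hdy,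
      dx_X_zero_pow, dx_X_one_pow, dy_X_zero_pow, dy_X_one_pow, mul_zero, add_zero, zero_add]
    push_cast
    linear_combination -(r + 1 : MvPolynomial (Fin 2) k) * X 0 ^ p * X 1 ^ q *
      (X 0 - X 1) ^ r * hG

theorem exists_act_eq_mul (p q r n : ℕ) (g : MvPolynomial (Fin 2) k)
    (u : Fin 2 → Polynomial k) (c : Polynomial k)
    (hc : (p : Polynomial k) * u 0 ^ n + (q : Polynomial k) * u 1 ^ n +
      (r : Polynomial k) * ∑ i ∈ Finset.range (n + 1), u 0 ^ i * u 1 ^ (n + 1 - 1 - i) -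
      (n : Polynomial k) * (u 0 ^ n + u 1 ^ n) = c) :
    ∃ h, act n (X 0 ^ p * X 1 ^ q * (X 0 - X 1) ^ r * g) =
        X 0 ^ p * X 1 ^ q * (X 0 - X 1) ^ r * h ∧
      aeval u h = u 0 ^ n * aeval u (dx g) + u 1 ^ n * aeval u (dy g) + c * aeval u g := by
  refine ⟨X 0 ^ n * dx g + X 1 ^ n * dy g +
    ((p : MvPolynomial (Fin 2) k) * X 0 ^ n + (q : MvPolynomial (Fin 2) k) * X 1 ^ n +
        (r : MvPolynomial (Fin 2) k) *
          ∑ i ∈ Finset.range (n + 1), X 0 ^ i * X 1 ^ (n + 1 - 1 - i) -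
        (n : MvPolynomial (Fin 2) k) * (X 0 ^ n + X 1 ^ n)) * g, ?_, ?_⟩
  · rw [act, Derivation.leibniz dx _ g, Derivation.leibniz dy _ g]
    simp only [smul_eq_mul]
    linear_combination g * vectorField_monomial (k := k) p q r n
  · simp only [map_add, map_mul, map_sub, map_sum, map_pow, map_natCast, aeval_X]
    rw [hc]

section Steps

variable {M : ℕ → Submodule k (MvPolynomial (Fin 2) k)} [CharZero k]

theorem stableAlong_of_X_zero (hmono : Monotone M)
    (hact : ∀ m n, 1 ≤ n → ∀ f ∈ M m, act n f ∈ M m) (p q r : ℕ)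
    (h : StableAlong M (X 0 ^ (p + 1) * X 1 ^ q * (X 0 - X 1) ^ r)) :
    StableAlong M (X 0 ^ p * X 1 ^ q * (X 0 - X 1) ^ r) := by
  refine stableAlong_of_mul hmono hact (l := X 0) (aeval ![0, Polynomial.X]) (fun g hg => ?_)
    (q + r) (-1) (fun n hn g => ?_) (by convert h using 1; ring)
  · have := dvd_sub_section (l := X 0)
      ((Polynomial.aeval (X 1)).comp (aeval ![0, Polynomial.X])) (fun i => ?_) g
    · simpa [hg] using this
    · fin_cases i <;> simp
  · obtain ⟨h, h1, h2⟩ := exists_act_eq_mul p q r n g ![0, Polynomial.X]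
      (Polynomial.X ^ n * Polynomial.C (q + r + n * (-1) : k)) (by
        have hG := (Commute.all (0 : Polynomial k) Polynomial.X).geom_sum₂_mul (n + 1)
        -- Only the term `i = 0` survives, with `0 ^ 0 = 1`; the value is read off from the
        -- telescoping identity.
        have hG' : ∑ i ∈ Finset.range (n + 1), (0 : Polynomial k) ^ i *
            Polynomial.X ^ (n + 1 - 1 - i) = Polynomial.X ^ n := by
          refine mul_right_cancel₀ (Polynomial.X_ne_zero (R := k)) ?_
          rw [zero_pow (Nat.succ_ne_zero n)] at hG
          linear_combination -hG
        simp only [Matrix.cons_val_zero, Matrix.cons_val_one, hG', zero_pow (by omega : n ≠ 0),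
          map_add, map_mul, map_neg, map_one, map_natCast]
        ring)
    refine ⟨h, h1, ?_⟩
    have h3 := aeval_euler ![0, Polynomial.X] (by intro i; fin_cases i <;> simp) g
    have h4 : aeval ![0, Polynomial.X] (dx g) = (0 : Polynomial k) := by simp [dx_apply]
    rw [h2, densityAct, ← h3, h4]
    simp only [Matrix.cons_val_zero, Matrix.cons_val_one]
    ring

theorem stableAlong_of_X_one (hmono : Monotone M)
    (hact : ∀ m n, 1 ≤ n → ∀ f ∈ M m, act n f ∈ M m) (p q r : ℕ)
    (h : StableAlong M (X 0 ^ p * X 1 ^ (q + 1) * (X 0 - X 1) ^ r)) :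
    StableAlong M (X 0 ^ p * X 1 ^ q * (X 0 - X 1) ^ r) := by
  refine stableAlong_of_mul hmono hact (l := X 1) (aeval ![Polynomial.X, 0]) (fun g hg => ?_)
    (p + r) (-1) (fun n hn g => ?_) (by convert h using 1; ring)
  · have := dvd_sub_section (l := X 1)
      ((Polynomial.aeval (X 0)).comp (aeval ![Polynomial.X, 0])) (fun i => ?_) g
    · simpa [hg] using this
    · fin_cases i <;> simp
  · obtain ⟨h, h1, h2⟩ := exists_act_eq_mul p q r n g ![Polynomial.X, 0]
      (Polynomial.X ^ n * Polynomial.C (p + r + n * (-1) : k)) (by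
        have hG := (Commute.all (Polynomial.X : Polynomial k) 0).geom_sum₂_mul (n + 1)
        have hG' : ∑ i ∈ Finset.range (n + 1), (Polynomial.X : Polynomial k) ^ i *
            0 ^ (n + 1 - 1 - i) = Polynomial.X ^ n := by
          refine mul_right_cancel₀ (Polynomial.X_ne_zero (R := k)) ?_
          rw [zero_pow (Nat.succ_ne_zero n)] at hG
          linear_combination hG
        simp only [Matrix.cons_val_zero, Matrix.cons_val_one, hG', zero_pow (by omega : n ≠ 0),
          map_add, map_mul, map_neg, map_one, map_natCast]
        ring)
    refine ⟨h, h1, ?_⟩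
    have h3 := aeval_euler ![Polynomial.X, 0] (by intro i; fin_cases i <;> simp) g
    have h4 : aeval ![Polynomial.X, 0] (dy g) = (0 : Polynomial k) := by simp [dy_apply]
    rw [h2, densityAct, ← h3, h4]
    simp only [Matrix.cons_val_zero, Matrix.cons_val_one]
    ring

/-- On the diagonal the cofactor of `(x - y)ʳ` becomes `r(n + 1)tⁿ`, and the term `-n(xⁿ + yⁿ)` of
the action becomes `-2n tⁿ`; hence `a = p + q + r` and `b = r - 2`. -/
theorem stableAlong_of_X_zero_sub_X_one (hmono : Monotone M)
    (hact : ∀ m n, 1 ≤ n → ∀ f ∈ M m, act n f ∈ M m) (p q r : ℕ)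
    (h : StableAlong M (X 0 ^ p * X 1 ^ q * (X 0 - X 1) ^ (r + 1))) :
    StableAlong M (X 0 ^ p * X 1 ^ q * (X 0 - X 1) ^ r) := by
  refine stableAlong_of_mul hmono hact (l := X 0 - X 1) (aeval ![Polynomial.X, Polynomial.X])
    (fun g hg => ?_) (p + q + r) (r - 2) (fun n hn g => ?_) (by convert h using 1; ring)
  · have := dvd_sub_section (l := X 0 - X 1)
      ((Polynomial.aeval (X 1)).comp (aeval ![Polynomial.X, Polynomial.X])) (fun i => ?_) g
    · simpa [hg] using this
    · fin_cases i <;> simp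
  · obtain ⟨h, h1, h2⟩ := exists_act_eq_mul p q r n g ![Polynomial.X, Polynomial.X]
      (Polynomial.X ^ n * Polynomial.C (p + q + r + n * (r - 2) : k)) (by
        simp only [Matrix.cons_val_zero, Matrix.cons_val_one, geom_sum₂_self, map_add, map_mul,
          map_sub,
          map_natCast, map_ofNat Polynomial.C 2]
        rw [Nat.add_sub_cancel]
        push_cast
        ring)
    refine ⟨h, h1, ?_⟩
    have h3 := aeval_euler ![Polynomial.X, Polynomial.X] (by intro i; fin_cases i <;> simp) g
    rw [h2, densityAct, ← h3]
    simp only [Matrix.cons_val_zero, Matrix.cons_val_one]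
    ring

theorem chain_stable_of_stableAlong (hmono : Monotone M)
    (hact : ∀ m n, 1 ≤ n → ∀ f ∈ M m, act n f ∈ M m) (p q r : ℕ)
    (h : StableAlong M (X 0 ^ p * X 1 ^ q * (X 0 - X 1) ^ r)) :
    ∃ N, ∀ n, N ≤ n → M n = M N := by
  induction p with
  | succ p ih => exact ih (stableAlong_of_X_zero hmono hact p q r h)
  | zero =>
  induction q with
  | succ q ih => exact ih (stableAlong_of_X_one hmono hact 0 q r h)
  | zero =>
  induction r with
  | succ r ih => exact ih (stableAlong_of_X_zero_sub_X_one hmono hact 0 0 r h)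
  | zero =>
  obtain ⟨N, hN⟩ := h
  exact ⟨N, fun n hn => le_antisymm (fun g hg => by simpa using hN n hn g (by simpa using hg))
    (hmono hn)⟩

end Steps

/-- The ascending chain condition on the Witt-stable subspaces of `xy k[x, y]` that contain the
antisymmetric polynomials. -/
theorem chain_stable [CharZero k] {M : ℕ → Submodule k (MvPolynomial (Fin 2) k)}
    (hmono : Monotone M) (hact : ∀ m n, 1 ≤ n → ∀ f ∈ M m, act n f ∈ M m)
    (hswap : ∀ m f, X 0 * X 1 ∣ f → f - swap f ∈ M m)
    (hdvd : ∀ m, ∀ f ∈ M m, X 0 * X 1 ∣ f) :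
    ∃ N, ∀ n, N ≤ n → M n = M N := by
  by_cases hex : ∃ m, ∃ f ∈ M m, f + swap f ≠ 0
  · obtain ⟨m, f, hf, hf0⟩ := hex
    have hmem : f + swap f ∈ M m := by
      convert (M m).sub_mem ((M m).add_mem hf hf) (hswap m f (hdvd m f hf)) using 1
      ring
    obtain ⟨N, hN⟩ := exists_pow_mem_core (hact m) (hswap m) hmem
      (by rw [map_add, swap_swap, add_comm]) (hdvd m _ hmem) hf0
    -- `M m` already contains every multiple of `(x²y²(x - y))^N`, so along this polynomial the
    -- chain is constant from `m` on.
    refine chain_stable_of_stableAlong hmono hact (2 * N) (2 * N) N ⟨m, fun n _ g _ => ?_⟩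
    convert hN g using 1
    rw [mul_pow, mul_pow, ← pow_mul, ← pow_mul]
  -- Otherwise every member consists of antisymmetric polynomials `f` divisible by `xy`, and `2f = f
  -- - swap f` already lies in `M 0`.
  · push Not at hex
    refine ⟨0, fun n _ => le_antisymm (fun f hf => ?_) (hmono (Nat.zero_le n))⟩
    have h1 := hswap 0 f (hdvd n f hf)
    have h2 : (2 : k) • f ∈ M 0 := by
      convert h1 using 1
      rw [two_smul]
      linear_combination hex n f hf
    exact ((M 0).smul_mem_iff two_ne_zero).1 h2

end Chains

/-! ### From Poisson ideals to stable subspaces of `xy k[x, y]` -/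

section Quadratic

open MvPolynomial

/-- The linear map from `k[x, y]` onto `S²(W₊)` with `xᵖ y^q ↦ e (p + 1) * e (q + 1)`. -/
def toQuadratic : MvPolynomial (Fin 2) k →ₗ[k] SymmetricAlgebra k (PositiveWitt k) :=
  (MvPolynomial.basisMonomials (Fin 2) k).constr k fun u =>
    SymmetricAlgebra.ι k _ (PositiveWitt.e k (u 0).succPNat) *
      SymmetricAlgebra.ι k _ (PositiveWitt.e k (u 1).succPNat)

theorem toQuadratic_X_pow_mul_X_pow (p q : ℕ) :
    toQuadratic (X 0 ^ p * X 1 ^ q : MvPolynomial (Fin 2) k) =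
      SymmetricAlgebra.ι k _ (PositiveWitt.e k p.succPNat) *
        SymmetricAlgebra.ι k _ (PositiveWitt.e k q.succPNat) := by
  have h : (X 0 ^ p * X 1 ^ q : MvPolynomial (Fin 2) k) =
      MvPolynomial.basisMonomials (Fin 2) k (Finsupp.single 0 p + Finsupp.single 1 q) := by
    rw [MvPolynomial.coe_basisMonomials, MvPolynomial.X_pow_eq_monomial,
      MvPolynomial.X_pow_eq_monomial, MvPolynomial.monomial_mul, one_mul]
  rw [h, toQuadratic, Module.Basis.constr_basis]
  simp

theorem toQuadratic_swap (f : MvPolynomial (Fin 2) k) :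
    toQuadratic (swap f) = toQuadratic f := by
  induction f using polynomial_induction with
  | hadd f g hf hg => simp only [map_add, hf, hg]
  | hsmul c f hf => simp only [map_smul, hf]
  | hmon p q =>
    simp only [map_mul, map_pow, swap_X_zero, swap_X_one]
    rw [mul_comm (X 1 ^ p), toQuadratic_X_pow_mul_X_pow, toQuadratic_X_pow_mul_X_pow, mul_comm]

/-- The action of `e n` on `S²(W₊)`, where `e (p + 1) * e (q + 1)` corresponds to `xᵖ y^q`. -/
def shiftedAct (n : ℕ) (f : MvPolynomial (Fin 2) k) : MvPolynomial (Fin 2) k :=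
  X 0 ^ n * (dx f + f - (n : MvPolynomial (Fin 2) k) * f) +
    X 1 ^ n * (dy f + f - (n : MvPolynomial (Fin 2) k) * f)

/-- The factor `xy` undoes the index shift of `toQuadratic`, turning `xᵖ y^q` for `e (p + 1) * e (q
+ 1)` into `xᵖ⁺¹ y^(q+1)`. -/
theorem act_mul (n : ℕ) (f : MvPolynomial (Fin 2) k) :
    act n (X 0 * X 1 * f) = X 0 * X 1 * shiftedAct n f := by
  simp only [act, shiftedAct, Derivation.leibniz, smul_eq_mul, dx_X_zero, dx_X_one, dy_X_zero,
    dy_X_one]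
  ring

theorem toQuadratic_shiftedAct [CharZero k] (n : ℕ+) (f : MvPolynomial (Fin 2) k) :
    toQuadratic (shiftedAct n f) =
      SymmetricAlgebra.adDerivation (PositiveWitt.e k n) (toQuadratic f) := by
  induction f using polynomial_induction with
  | hadd f g hf hg =>
    rw [map_add, map_add, ← hf, ← hg, ← map_add]
    congr 1
    simp only [shiftedAct, map_add]
    ring
  | hsmul c f hf =>
    rw [map_smul, Derivation.map_smul, ← hf, ← map_smul]
    congr 1
    simp only [shiftedAct, Derivation.map_smul, mul_smul_comm, ← smul_add, ← smul_sub]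
  | hmon p q =>
    have h1 : shiftedAct n (X 0 ^ p * X 1 ^ q : MvPolynomial (Fin 2) k) =
        ((p.succPNat : ℕ) - (n : ℕ) : k) • (X 0 ^ (n + p : ℕ) * X 1 ^ q) +
          ((q.succPNat : ℕ) - (n : ℕ) : k) • (X 0 ^ p * X 1 ^ (n + q : ℕ)) := by
      simp only [shiftedAct, Derivation.leibniz, smul_eq_mul, dx_X_zero_pow, dx_X_one_pow,
        dy_X_zero_pow, dy_X_one_pow, MvPolynomial.smul_eq_C_mul, map_sub, map_natCast,
        Nat.succPNat_coe, Nat.succ_eq_add_one]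
      push_cast
      ring
    have h2 (i : ℕ) : ⁅PositiveWitt.e k n, PositiveWitt.e k i.succPNat⁆ =
        ((i.succPNat : ℕ) - (n : ℕ) : k) • PositiveWitt.e k (n + i : ℕ).succPNat := by
      have : n + i.succPNat = (n + i : ℕ).succPNat := by
        apply PNat.eq
        simp [Nat.succPNat_coe, add_assoc]
      rw [← this]
      exact PositiveWitt.lieHom_e k n i.succPNat
    rw [h1, map_add, map_smul, map_smul]
    simp only [toQuadratic_X_pow_mul_X_pow, Derivation.leibniz, smul_eq_mul,
      SymmetricAlgebra.adDerivation_ι, h2, map_smul, mul_smul_comm]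
    rw [add_comm, mul_comm (SymmetricAlgebra.ι k _ (PositiveWitt.e k q.succPNat))]

theorem homogeneousPart_two_le_range_toQuadratic [CharZero k] :
    SymmetricAlgebra.homogeneousPart k (PositiveWitt k) 2 ≤
      LinearMap.range (toQuadratic (k := k)) := by
  have hr : LinearMap.range (SymmetricAlgebra.ι k (PositiveWitt k)) =
      Submodule.span k
        (Set.range fun i => SymmetricAlgebra.ι k (PositiveWitt k) (PositiveWitt.e k i)) := by
    rw [LinearMap.range_eq_map, ← (PositiveWitt.e k).span_eq, Submodule.map_span,
      ← Set.range_comp]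
    rfl
  rw [SymmetricAlgebra.homogeneousPart, pow_two, hr, Submodule.span_mul_span, Submodule.span_le]
  rintro _ ⟨_, ⟨i, rfl⟩, _, ⟨j, rfl⟩, rfl⟩
  refine ⟨X 0 ^ i.natPred * X 1 ^ j.natPred, ?_⟩
  rw [toQuadratic_X_pow_mul_X_pow]
  simp

/-- The polynomials that represent the quadratic elements of an ideal. -/
def quadraticPart (I : Ideal (SymmetricAlgebra k (PositiveWitt k))) :
    Submodule k (MvPolynomial (Fin 2) k) :=
  ((I.restrictScalars k).comap toQuadratic).map (LinearMap.mulLeft k (X 0 * X 1))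

theorem mul_mem_quadraticPart {I : Ideal (SymmetricAlgebra k (PositiveWitt k))}
    {f : MvPolynomial (Fin 2) k} : X 0 * X 1 * f ∈ quadraticPart I ↔ toQuadratic f ∈ I := by
  constructor
  · rintro ⟨g, hg, h⟩
    have := mul_left_cancel₀ (mul_ne_zero (MvPolynomial.X_ne_zero 0) (MvPolynomial.X_ne_zero 1)) h
    exact this ▸ hg
  · exact fun h => ⟨f, h, rfl⟩

theorem dvd_of_mem_quadraticPart {I : Ideal (SymmetricAlgebra k (PositiveWitt k))}
    {f : MvPolynomial (Fin 2) k} (hf : f ∈ quadraticPart I) : X 0 * X 1 ∣ f := by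
  obtain ⟨g, -, rfl⟩ := hf
  exact ⟨g, rfl⟩

theorem act_mem_quadraticPart [CharZero k] {I : Ideal (SymmetricAlgebra k (PositiveWitt k))}
    (hI : SymmetricAlgebra.IsPoissonIdeal I) {n : ℕ} (hn : 1 ≤ n)
    {f : MvPolynomial (Fin 2) k} (hf : f ∈ quadraticPart I) : act n f ∈ quadraticPart I := by
  obtain ⟨g, rfl⟩ := dvd_of_mem_quadraticPart hf
  rw [mul_mem_quadraticPart] at hf
  rw [act_mul, mul_mem_quadraticPart]
  have := toQuadratic_shiftedAct (⟨n, hn⟩ : ℕ+) g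
  rw [PNat.mk_coe] at this
  rw [this, ← SymmetricAlgebra.poissonBracket_ι_left]
  exact hI _ _ hf

theorem sub_swap_mem_quadraticPart (I : Ideal (SymmetricAlgebra k (PositiveWitt k)))
    {f : MvPolynomial (Fin 2) k} (hf : X 0 * X 1 ∣ f) : f - swap f ∈ quadraticPart I := by
  obtain ⟨g, rfl⟩ := hf
  have e : X 0 * X 1 * g - swap (X 0 * X 1 * g) = X 0 * X 1 * (g - swap g) := by
    simp only [map_mul, swap_X_zero, swap_X_one]
    ring
  rw [e, mul_mem_quadraticPart, map_sub, toQuadratic_swap, sub_self]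
  exact I.zero_mem

theorem quadraticPart_mono : Monotone (quadraticPart (k := k)) :=
  fun _ _ h => Submodule.map_mono fun _ hf => h hf

theorem poissonSpan_le {L : Type*} [LieRing L] [LieAlgebra k L] {Y : Set (SymmetricAlgebra k L)}
    {I : Ideal (SymmetricAlgebra k L)} (hI : SymmetricAlgebra.IsPoissonIdeal I) (h : Y ⊆ I) :
    SymmetricAlgebra.poissonSpan Y ≤ I :=
  sInf_le ⟨hI, h⟩

/-- Only surjectivity of `toQuadratic` onto the quadratic elements is needed: `quadraticPart` comes
from a full preimage, so the kernel is harmless. -/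
theorem le_of_quadraticPart_le [CharZero k] {I J : Ideal (SymmetricAlgebra k (PositiveWitt k))}
    (hI : SymmetricAlgebra.IsQuadraticallyGenerated I) (hJ : SymmetricAlgebra.IsPoissonIdeal J)
    (h : quadraticPart I ≤ quadraticPart J) : I ≤ J := by
  obtain ⟨Y, hY, rfl⟩ := hI
  refine poissonSpan_le hJ fun a ha => ?_
  obtain ⟨f, rfl⟩ := homogeneousPart_two_le_range_toQuadratic (hY ha)
  exact mul_mem_quadraticPart.1
    (h (mul_mem_quadraticPart.2 (SymmetricAlgebra.subset_poissonSpan Y ha)))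

theorem isPoissonIdeal_of_isQuadraticallyGenerated [CharZero k]
    {I : Ideal (SymmetricAlgebra k (PositiveWitt k))}
    (hI : SymmetricAlgebra.IsQuadraticallyGenerated I) : SymmetricAlgebra.IsPoissonIdeal I := by
  obtain ⟨Y, -, rfl⟩ := hI
  exact SymmetricAlgebra.isPoissonIdeal_poissonSpan Y

end Quadratic

end WittQuadratic

end

/-- The ascending chain condition on the Poisson ideals of the symmetric algebra of the positive
Witt algebra that are generated by quadratic elements. -/
theorem corollary4p4 (k : Type*) [Field k] [CharZero k]
    (I : ℕ → Ideal (SymmetricAlgebra k (PositiveWitt k)))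
    (hI : ∀ n, SymmetricAlgebra.IsQuadraticallyGenerated (I n))
    (hmono : ∀ n, I n ≤ I (n + 1)) :
    ∃ N, ∀ n, N ≤ n → I n = I N := by
  have hP n := WittQuadratic.isPoissonIdeal_of_isQuadraticallyGenerated (hI n)
  have hmono' := monotone_nat_of_le_succ hmono
  obtain ⟨N, hN⟩ := WittQuadratic.chain_stable (M := fun n => WittQuadratic.quadraticPart (I n))
    (WittQuadratic.quadraticPart_mono.comp hmono')
    (fun m _ hn _ hf => WittQuadratic.act_mem_quadraticPart (hP m) hn hf)
    (fun m _ hf => WittQuadratic.sub_swap_mem_quadraticPart (I m) hf)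
    (fun _ _ hf => WittQuadratic.dvd_of_mem_quadraticPart hf)
  exact ⟨N, fun n hn => le_antisymm
    (WittQuadratic.le_of_quadraticPart_le (hI n) (hP N) (hN n hn).le) (hmono' hn)⟩
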